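/- Let $d \ge 1$ be an integer and let $\Omega \subset \mathbb{R}^d$ be a smooth bounded open set, with Lebesgue measure $|\Omega|$. For $\delta > 0$ and $u \in L^1(\Omega)$ real-valued, set $$ I_{\delta,d}(u,\Omega) = \mathop{\int_\Omega\int_\Omega}_{|u(x)-u(y)|>\delta} \frac{\delta^d}{|x-y|^{2d}}\,dx\,dy \in [0,\infty]. $$ Given $\alpha > 0$, there exist positive constants $M_0$ and $C_\Omega$, depending only on $\alpha$, $d$ and $\Omega$, such that for every $\delta > 0$ and every $u \in L^1(\Omega)$ with $\delta^{-d} I_{\delta,d}(u,\Omega) \le M_0$, the function $e^{\alpha\delta^{-1}|u|}$ is integrable on $\Omega$ and $$ \int_\Omega e^{\alpha \delta^{-1}|u|}\,dx \le C_\Omega \exp\Big(\alpha\,\delta^{-1}\,\frac{1}{|\Omega|}\,\|u\|_{L^1(\Omega)}\Big). $$ (For $\Omega=\emptyset$ the inequality reads $0\le C_\Omega$.) -/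

import Mathlib

open MeasureTheory
open scoped ContDiff

/-- `Ω ⊆ ℝ^d` is a smooth bounded open set: near each boundary point it is the sublevel set
`{φ < 0}` of a smooth function `φ` whose differential does not vanish at that point (so that the
boundary is a smooth hypersurface and `Ω` lies locally on one side of it). -/
structure IsSmoothBoundedOpen {d : ℕ} (Ω : Set (EuclideanSpace ℝ (Fin d))) : Prop where
  isOpen : IsOpen Ω
  isBounded : Bornology.IsBounded Ω
  smooth_boundary : ∀ x₀ ∈ frontier Ω, ∃ U : Set (EuclideanSpace ℝ (Fin d)),
    IsOpen U ∧ x₀ ∈ U ∧ ∃ φ : EuclideanSpace ℝ (Fin d) → ℝ,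
      ContDiffOn ℝ ∞ φ U ∧ fderiv ℝ φ x₀ ≠ 0 ∧ Ω ∩ U = {x ∈ U | φ x < 0}

/-- The nonlocal functional
`I_{δ,p}(u, O) = ∫_O ∫_O 1_{|u(x) - u(y)| > δ} δ^p / |x - y|^(d + p) dy dx ∈ [0, ∞]`. -/
noncomputable def nonlocalI {d : ℕ} (δ p : ℝ) (u : EuclideanSpace ℝ (Fin d) → ℝ)
    (O : Set (EuclideanSpace ℝ (Fin d))) : ENNReal :=
  ∫⁻ x in O, ∫⁻ y in {y ∈ O | δ < |u x - u y|},
    ENNReal.ofReal (δ ^ p / ‖x - y‖ ^ ((d : ℝ) + p))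

/-!
For `v = u / δ` the hypothesis says that
`∫∫_{|v x - v y| > 1} ‖x - y‖ ^ (-2d) ≤ M₀` over `Ω × Ω`, and the key point is that a small such
energy forces the level sets `F t = {x ∈ Ω | t < |v x - m|}` to decay at any prescribed geometric
rate. Indeed `v` jumps by more than `1` between `F (t + 1)` and `Ω \ F t`. If `F t` has small
measure `A`, then around each `x ∈ F (t + 1)` a ball of radius comparable to `A ^ (1 / d)` meets
`Ω \ F t` in measure at least `A`; there the kernel is at least a multiple of `A ^ (-2)`, so
`|F (t + 1)| * A * A ^ (-2) ≤ C * M₀`, that is `|F (t + 1)| ≤ C * M₀ * |F t|`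
(`volume_le_of_jump`). This uses only that `Ω` is bounded and lower Ahlfors regular, which follows
from the smoothness of its boundary by strict differentiability and compactness
(`IsSmoothBoundedOpen.measure_density`).

To start the iteration, averaging the energy over `y ∈ Ω` gives a value `m = v y` for which `F 1`
is small (`exists_volume_jump_le`). Summing over the layers bounds `∫ exp (α |v - m|)` by a constant
(`lintegral_exp_le_of_superlevel_le`). In particular the mean of `α |v - m|` is bounded, so
`α |m|` exceeds the mean of `α |v|` by at most a constant, and `|v| ≤ |m| + |v - m|` gives the claim
(`integral_exp_abs_le`).
-/

/-! ### Lower Ahlfors regularity of smooth bounded open sets -/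

/-- Cone condition at a boundary point: strict differentiability makes `φ` decrease from every
nearby `x` in all directions close to one with `φ' e < 0`, so `Ω ∩ ball x r` contains a ball
whose radius is a fixed fraction of `r`. -/
lemma measure_density_near_boundary {d : ℕ} {Ω U : Set (EuclideanSpace ℝ (Fin d))}
    {x₀ : EuclideanSpace ℝ (Fin d)} (hU : IsOpen U) (hx₀ : x₀ ∈ U)
    {φ : EuclideanSpace ℝ (Fin d) → ℝ} {φ' : EuclideanSpace ℝ (Fin d) →L[ℝ] ℝ}
    (hφ : HasStrictFDerivAt φ φ' x₀) (hφ' : φ' ≠ 0) (hΩU : Ω ∩ U = {x ∈ U | φ x < 0}) :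
    ∃ c R : ℝ, 0 < c ∧ 0 < R ∧ ∀ x ∈ Ω ∩ Metric.ball x₀ R, ∀ r : ℝ, 0 < r → r ≤ R →
      ENNReal.ofReal (c * r ^ d) ≤ volume (Metric.ball x r ∩ Ω) := by
  obtain ⟨e, he⟩ : ∃ e, φ' e < 0 := by
    obtain ⟨e, he⟩ : ∃ e, φ' e ≠ 0 := by
      by_contra! h
      exact hφ' (ContinuousLinearMap.ext h)
    rcases lt_or_gt_of_ne he with h | h
    · exact ⟨e, h⟩
    · exact ⟨-e, by simpa using h⟩
  -- The slope stays negative after the error `ε * ‖w‖` of the linear approximation.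
  obtain ⟨ε, hε, hneg⟩ : ∃ ε > 0, φ' e + ε * ‖e‖ < 0 := by
    refine ⟨-φ' e / (2 * (‖e‖ + 1)), div_pos (neg_pos.2 he) (by positivity), ?_⟩
    have h : -φ' e / (2 * (‖e‖ + 1)) * ‖e‖ < -φ' e := by
      rw [div_mul_eq_mul_div, div_lt_iff₀ (by positivity)]
      nlinarith [norm_nonneg e]
    linarith
  obtain ⟨η, hη, hcone⟩ : ∃ η > 0, ∀ w ∈ Metric.ball e η, φ' w + ε * ‖w‖ < 0 := by
    have hopen : IsOpen {w | φ' w + ε * ‖w‖ < 0} := isOpen_lt (by fun_prop) continuous_const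
    obtain ⟨η, hη, h⟩ := Metric.isOpen_iff.1 hopen e hneg
    exact ⟨η, hη, fun w hw => h hw⟩
  obtain ⟨ρ, hρ, hnear⟩ : ∃ ρ > 0, ∀ x ∈ Metric.ball x₀ ρ, ∀ y ∈ Metric.ball x₀ ρ,
      x ∈ U ∧ φ y - φ x - φ' (y - x) ≤ ε * ‖y - x‖ := by
    have h1 := hφ.isLittleO.bound hε
    rw [nhds_prod_eq] at h1
    obtain ⟨V, hV, hVV⟩ := Filter.mem_prod_same_iff.1 h1
    obtain ⟨ρ, hρ, hball⟩ := Metric.mem_nhds_iff.1 (Filter.inter_mem hV (hU.mem_nhds hx₀))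
    refine ⟨ρ, hρ, fun x hx y hy => ⟨(hball hx).2, ?_⟩⟩
    exact (le_abs_self _).trans (hVV (Set.mk_mem_prod (hball hy).1 (hball hx).1))
  have hK : 0 < ‖e‖ + η := by positivity
  refine ⟨(η / (‖e‖ + η)) ^ d * volume.real (Metric.ball (0 : EuclideanSpace ℝ (Fin d)) 1), ρ / 2,
    ?_, by positivity, ?_⟩
  · have : 0 < volume.real (Metric.ball (0 : EuclideanSpace ℝ (Fin d)) 1) :=
      ENNReal.toReal_pos (Metric.measure_ball_pos _ _ one_pos).ne' measure_ball_lt_top.ne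
    positivity
  rintro x ⟨hxΩ, hx⟩ r hr hrR
  rw [Metric.mem_ball, dist_eq_norm] at hx
  set s := r / (‖e‖ + η) with hs
  have hs0 : 0 < s := by positivity
  have hsub : Metric.ball (x + s • e) (s * η) ⊆ Metric.ball x r ∩ Ω := by
    intro y hy
    obtain ⟨w, rfl⟩ : ∃ w, y = x + s • w := ⟨s⁻¹ • (y - x), by
      rw [smul_smul, mul_inv_cancel₀ hs0.ne', one_smul]; abel⟩
    have hw : ‖w - e‖ < η := by
      rw [Metric.mem_ball, dist_eq_norm, add_sub_add_left_eq_sub, ← smul_sub, norm_smul,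
        Real.norm_of_nonneg hs0.le] at hy
      exact lt_of_mul_lt_mul_left hy hs0.le
    have hwn : ‖w‖ < ‖e‖ + η := by
      have := norm_add_le e (w - e)
      rw [add_sub_cancel] at this
      linarith
    have hsw : ‖s • w‖ < r := by
      rw [norm_smul, Real.norm_of_nonneg hs0.le]
      calc s * ‖w‖ < s * (‖e‖ + η) := by gcongr
        _ = r := div_mul_cancel₀ _ hK.ne'
    have hxρ : x ∈ Metric.ball x₀ ρ := by
      rw [Metric.mem_ball, dist_eq_norm]; linarith
    have hyρ : x + s • w ∈ Metric.ball x₀ ρ := by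
      rw [Metric.mem_ball, dist_eq_norm, add_sub_right_comm]
      linarith [norm_add_le (x - x₀) (s • w)]
    refine ⟨by simpa [Metric.mem_ball, dist_eq_norm] using hsw, ?_⟩
    have hφx : φ x < 0 := (hΩU.subset ⟨hxΩ, (hnear x hxρ x hxρ).1⟩).2
    have hlin := (hnear x hxρ _ hyρ).2
    rw [add_sub_cancel_left, map_smul, norm_smul, Real.norm_of_nonneg hs0.le, smul_eq_mul] at hlin
    have hdec : s * (φ' w + ε * ‖w‖) < 0 :=
      mul_neg_of_pos_of_neg hs0 (hcone w (by rwa [Metric.mem_ball, dist_eq_norm]))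
    exact (hΩU.symm.subset ⟨(hnear _ hyρ x hxρ).1, by nlinarith⟩).1
  refine le_trans (le_of_eq ?_) (measure_mono hsub)
  rw [Measure.addHaar_ball_of_pos _ _ (by positivity), finrank_euclideanSpace_fin,
    ← ofReal_measureReal measure_ball_lt_top.ne, ← ENNReal.ofReal_mul (by positivity)]
  congr 1
  rw [hs, div_mul_eq_mul_div, mul_comm r, mul_div_right_comm, mul_pow]
  ring

/-- A smooth bounded open set is lower Ahlfors regular: balls of radius at most `R` centred in `Ω`
meet it in a fixed proportion of their volume. -/
lemma IsSmoothBoundedOpen.measure_density {d : ℕ} {Ω : Set (EuclideanSpace ℝ (Fin d))}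
    (hΩ : IsSmoothBoundedOpen Ω) :
    ∃ c R : ℝ, 0 < c ∧ 0 < R ∧ ∀ x ∈ Ω, ∀ r : ℝ, 0 < r → r ≤ R →
      ENNReal.ofReal (c * r ^ d) ≤ volume (Metric.ball x r ∩ Ω) := by
  suffices h : ∃ c R : ℝ, 0 < c ∧ 0 < R ∧ ∀ x ∈ Ω ∩ closure Ω, ∀ r : ℝ, 0 < r → r ≤ R →
      ENNReal.ofReal (c * r ^ d) ≤ volume (Metric.ball x r ∩ Ω) by
    rwa [Set.inter_eq_left.2 subset_closure] at h
  refine IsCompact.induction_on (p := fun S => ∃ c R : ℝ, 0 < c ∧ 0 < R ∧ ∀ x ∈ Ω ∩ S, ∀ r : ℝ,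
      0 < r → r ≤ R → ENNReal.ofReal (c * r ^ d) ≤ volume (Metric.ball x r ∩ Ω))
    hΩ.isBounded.isCompact_closure ⟨1, 1, one_pos, one_pos, by simp⟩ ?_ ?_ ?_
  · rintro S T hST ⟨c, R, hc, hR, h⟩
    exact ⟨c, R, hc, hR, fun x hx => h x ⟨hx.1, hST hx.2⟩⟩
  · rintro S T ⟨c, R, hc, hR, h⟩ ⟨c', R', hc', hR', h'⟩
    refine ⟨min c c', min R R', lt_min hc hc', lt_min hR hR', ?_⟩
    rintro x ⟨hx, hS | hT⟩ r hr hrR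
    · refine le_trans ?_ (h x ⟨hx, hS⟩ r hr (hrR.trans (min_le_left _ _)))
      gcongr
      exact min_le_left _ _
    · refine le_trans ?_ (h' x ⟨hx, hT⟩ r hr (hrR.trans (min_le_right _ _)))
      gcongr
      exact min_le_right _ _
  · intro x₀ hx₀
    suffices h : ∃ c R : ℝ, 0 < c ∧ 0 < R ∧ ∀ x ∈ Ω ∩ Metric.ball x₀ R, ∀ r : ℝ, 0 < r → r ≤ R →
        ENNReal.ofReal (c * r ^ d) ≤ volume (Metric.ball x r ∩ Ω) by
      obtain ⟨c, R, hc, hR, h⟩ := h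
      exact ⟨_, mem_nhdsWithin_of_mem_nhds (Metric.ball_mem_nhds x₀ hR), c, R, hc, hR, h⟩
    by_cases hxΩ : x₀ ∈ Ω
    · obtain ⟨ρ, hρ, hball⟩ := Metric.isOpen_iff.1 hΩ.isOpen x₀ hxΩ
      refine ⟨volume.real (Metric.ball (0 : EuclideanSpace ℝ (Fin d)) 1), ρ / 2,
        ENNReal.toReal_pos (Metric.measure_ball_pos _ _ one_pos).ne' measure_ball_lt_top.ne,
        by positivity, ?_⟩
      rintro x ⟨-, hx⟩ r hr hrR
      have hsub : Metric.ball x r ⊆ Ω :=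
        (Metric.ball_subset_ball' (by linarith [Metric.mem_ball.1 hx])).trans hball
      rw [Set.inter_eq_left.2 hsub, Measure.addHaar_ball_of_pos _ _ hr, finrank_euclideanSpace_fin,
        ← ofReal_measureReal measure_ball_lt_top.ne, ← ENNReal.ofReal_mul (by positivity), mul_comm]
    · have hfr : x₀ ∈ frontier Ω := ⟨hx₀, by rwa [hΩ.isOpen.interior_eq]⟩
      obtain ⟨U, hU, hxU, φ, hφ, hφ', hΩU⟩ := hΩ.smooth_boundary x₀ hfr
      exact measure_density_near_boundary hU hxU
        ((hφ.contDiffAt (hU.mem_nhds hxU)).hasStrictFDerivAt (by simp)) hφ' hΩU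

/-! ### Decay of level sets -/

/-- The `δ`-normalised functional is the `δ = 1` integral of `u / δ`. -/
lemma ofReal_rpow_mul_nonlocalI {d : ℕ} {δ : ℝ} (hδ : 0 < δ) (u : EuclideanSpace ℝ (Fin d) → ℝ)
    (Ω : Set (EuclideanSpace ℝ (Fin d))) :
    ENNReal.ofReal (δ ^ (-(d : ℝ))) * nonlocalI δ (d : ℝ) u Ω =
      ∫⁻ x in Ω, ∫⁻ y in {y ∈ Ω | 1 < |δ⁻¹ * u x - δ⁻¹ * u y|},
        ENNReal.ofReal (1 / ‖x - y‖ ^ (2 * d)) := by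
  have hset (x : EuclideanSpace ℝ (Fin d)) :
      {y ∈ Ω | 1 < |δ⁻¹ * u x - δ⁻¹ * u y|} = {y ∈ Ω | δ < |u x - u y|} := by
    ext y
    rw [Set.mem_ofPred_eq, Set.mem_ofPred_eq, ← mul_sub, abs_mul, abs_of_pos (inv_pos.2 hδ),
      lt_inv_mul_iff₀ hδ, mul_one]
  simp_rw [nonlocalI, hset]
  rw [← lintegral_const_mul' _ _ ENNReal.ofReal_ne_top]
  refine lintegral_congr fun x => ?_
  rw [← lintegral_const_mul' _ _ ENNReal.ofReal_ne_top]
  refine lintegral_congr fun y => ?_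
  rw [← ENNReal.ofReal_mul (by positivity), Real.rpow_neg hδ.le, ← mul_div_assoc,
    inv_mul_cancel₀ (by positivity), ← Nat.cast_add, Real.rpow_natCast, two_mul]

/-- If `v` jumps by more than `1` between `P` and `Ω \ Q`, and `Q` is small, then `P` is much
smaller than `Q`. For `x ∈ P`, a ball of volume comparable to `|Q|` about `x` meets `Ω \ Q` in
measure at least `|Q|`, so the kernel `‖x - y‖ ^ (-2d)` integrates there to at least a multiple of
`|Q|⁻¹`. -/
lemma volume_le_of_jump {d : ℕ} (hd : d ≠ 0) {Ω P Q : Set (EuclideanSpace ℝ (Fin d))} {c R M : ℝ}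
    (hc : 0 < c) (hR : 0 < R)
    (hdens : ∀ x ∈ Ω, ∀ r : ℝ, 0 < r → r ≤ R →
      ENNReal.ofReal (c * r ^ d) ≤ volume (Metric.ball x r ∩ Ω))
    {v : EuclideanSpace ℝ (Fin d) → ℝ}
    (hM : ∫⁻ x in Ω, ∫⁻ y in {y ∈ Ω | 1 < |v x - v y|},
      ENNReal.ofReal (1 / ‖x - y‖ ^ (2 * d)) ≤ ENNReal.ofReal M)
    (hP : NullMeasurableSet P) (hPQ : P ⊆ Q) (hPΩ : P ⊆ Ω)
    (hQ : volume Q ≤ ENNReal.ofReal (c * R ^ d / 2))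
    (hjump : ∀ x ∈ P, ∀ y ∈ Ω \ Q, 1 < |v x - v y|) :
    volume P ≤ ENNReal.ofReal (4 * M / c ^ 2) * volume Q := by
  have hQfin : volume Q ≠ ⊤ := (hQ.trans_lt ENNReal.ofReal_lt_top).ne
  rcases eq_or_ne (volume Q) 0 with h0 | h0
  · rw [measure_mono_null hPQ h0]
    exact zero_le
  set A := volume.real Q with hA
  have hA0 : 0 < A := ENNReal.toReal_pos h0 hQfin
  have hQA : volume Q = ENNReal.ofReal A := (ofReal_measureReal hQfin).symm
  have hAR : A ≤ c * R ^ d / 2 := by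
    rwa [hQA, ENNReal.ofReal_le_ofReal_iff (by positivity)] at hQ
  -- The radius at which the density bound gives volume `2 * A`.
  obtain ⟨r, hr, hrd⟩ : ∃ r : ℝ, 0 < r ∧ r ^ d = 2 * A / c :=
    ⟨(2 * A / c) ^ (d : ℝ)⁻¹, by positivity, Real.rpow_inv_natCast_pow (by positivity) hd⟩
  have hrR : r ≤ R := by
    refine le_of_pow_le_pow_left₀ hd hR.le ?_
    rw [hrd, div_le_iff₀ hc]
    linarith
  have hinner : ∀ x ∈ P, ENNReal.ofReal (c ^ 2 / (4 * A)) ≤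
      ∫⁻ y in {y ∈ Ω | 1 < |v x - v y|}, ENNReal.ofReal (1 / ‖x - y‖ ^ (2 * d)) := by
    intro x hx
    have hvol : ENNReal.ofReal A ≤ volume ((Metric.ball x r ∩ Ω) \ Q) := by
      refine le_trans ?_ le_measure_sdiff
      refine le_trans (le_of_eq ?_) (tsub_le_tsub_right (hdens x (hPΩ hx) r hr hrR) _)
      rw [hQA, ← ENNReal.ofReal_sub _ hA0.le, hrd]
      congr 1
      field_simp
      ring
    calc ENNReal.ofReal (c ^ 2 / (4 * A))
        = ENNReal.ofReal (1 / r ^ (2 * d)) * ENNReal.ofReal A := by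
          rw [← ENNReal.ofReal_mul (by positivity), mul_comm 2 d, pow_mul, hrd]
          congr 1
          field_simp
          ring
      _ ≤ ENNReal.ofReal (1 / r ^ (2 * d)) * volume ((Metric.ball x r ∩ Ω) \ Q) := by gcongr
      _ = ∫⁻ y in (Metric.ball x r ∩ Ω) \ Q, ENNReal.ofReal (1 / r ^ (2 * d)) := by
          rw [setLIntegral_const]
      _ ≤ ∫⁻ y in (Metric.ball x r ∩ Ω) \ Q, ENNReal.ofReal (1 / ‖x - y‖ ^ (2 * d)) := by
          refine lintegral_mono_ae ?_
          -- `x` itself, where the kernel takes the junk value `1 / 0 = 0`, lies in `Q`.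
          have hsub : (Metric.ball x r ∩ Ω) \ Q ⊆ Metric.ball x r \ {x} :=
            fun y hy => ⟨hy.1.1, fun hyx => hy.2 (hyx ▸ hPQ hx)⟩
          filter_upwards [ae_restrict_of_ae_restrict_of_subset hsub
            (ae_restrict_mem (measurableSet_ball.diff (measurableSet_singleton x)))] with y hy
          have hpos : 0 < ‖x - y‖ := norm_pos_iff.2 (sub_ne_zero.2 (Ne.symm hy.2))
          have hlt : ‖x - y‖ ≤ r := by
            rw [← dist_eq_norm, dist_comm]
            exact (Metric.mem_ball.1 hy.1).le
          gcongr
      _ ≤ _ := lintegral_mono_set (t := {y ∈ Ω | 1 < |v x - v y|})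
          fun y hy => ⟨hy.1.2, hjump x hx y ⟨hy.1.2, hy.2⟩⟩
  have hmain : ENNReal.ofReal (c ^ 2 / (4 * A)) * volume P ≤ ENNReal.ofReal M := by
    rw [← setLIntegral_const]
    refine le_trans ?_ ((lintegral_mono_set hPΩ).trans hM)
    exact lintegral_mono_ae ((ae_restrict_mem₀ hP).mono hinner)
  have hcoef : ENNReal.ofReal (4 * A / c ^ 2) * ENNReal.ofReal (c ^ 2 / (4 * A)) = 1 := by
    rw [← ENNReal.ofReal_mul (by positivity), ← ENNReal.ofReal_one]
    congr 1
    field_simp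
  calc volume P
      = ENNReal.ofReal (4 * A / c ^ 2) * (ENNReal.ofReal (c ^ 2 / (4 * A)) * volume P) := by
        rw [← mul_assoc, hcoef, one_mul]
    _ ≤ ENNReal.ofReal (4 * A / c ^ 2) * ENNReal.ofReal M := by gcongr
    _ = ENNReal.ofReal (4 * M / c ^ 2) * volume Q := by
        rw [hQA, ← ENNReal.ofReal_mul (by positivity), ← ENNReal.ofReal_mul' hA0.le]
        congr 1
        ring

lemma nullMeasurableSet_superlevel {X : Type*} [MeasurableSpace X] {μ : Measure X} {Ω : Set X}
    (hΩ : MeasurableSet Ω) {w : X → ℝ} (hw : AEMeasurable w (μ.restrict Ω)) (t : ℝ) :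
    NullMeasurableSet {x ∈ Ω | t < w x} μ := by
  have h := nullMeasurableSet_lt (aemeasurable_const (b := t)) hw
  rw [nullMeasurableSet_restrict hΩ.nullMeasurableSet] at h
  convert h using 1
  ext x
  simp [and_comm]

/-- Some value `m = v y` is `1`-close to `v` off a small part of `Ω`, by averaging over `y`: on the
bounded set `Ω` the kernel is bounded below. -/
lemma exists_volume_jump_le {d : ℕ} {Ω : Set (EuclideanSpace ℝ (Fin d))} (hΩ : MeasurableSet Ω)
    (hΩfin : volume Ω ≠ ⊤) {D M κ : ℝ} (hD : 0 < D) (hM0 : 0 ≤ M)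
    (hdiam : ∀ x ∈ Ω, ∀ y ∈ Ω, ‖x - y‖ ≤ D) {v : EuclideanSpace ℝ (Fin d) → ℝ}
    (hv : AEMeasurable v (volume.restrict Ω))
    (hM : ∫⁻ x in Ω, ∫⁻ y in {y ∈ Ω | 1 < |v x - v y|},
      ENNReal.ofReal (1 / ‖x - y‖ ^ (2 * d)) ≤ ENNReal.ofReal M)
    (hκ : 0 < κ) (hMκ : M * D ^ (2 * d) < κ * volume.real Ω) :
    ∃ m : ℝ, volume {x ∈ Ω | 1 < |v x - m|} ≤ ENNReal.ofReal κ := by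
  by_contra! hall
  have hinner : ∀ x ∈ Ω, ENNReal.ofReal (κ / D ^ (2 * d)) ≤
      ∫⁻ y in {y ∈ Ω | 1 < |v x - v y|}, ENNReal.ofReal (1 / ‖x - y‖ ^ (2 * d)) := by
    intro x hx
    have hlarge := (hall (v x)).le
    simp_rw [abs_sub_comm _ (v x)] at hlarge
    calc ENNReal.ofReal (κ / D ^ (2 * d))
        = ENNReal.ofReal (1 / D ^ (2 * d)) * ENNReal.ofReal κ := by
          rw [← ENNReal.ofReal_mul (by positivity), one_div_mul_eq_div]
      _ ≤ ENNReal.ofReal (1 / D ^ (2 * d)) * volume {y ∈ Ω | 1 < |v x - v y|} := by gcongr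
      _ = ∫⁻ y in {y ∈ Ω | 1 < |v x - v y|}, ENNReal.ofReal (1 / D ^ (2 * d)) := by
          rw [setLIntegral_const]
      _ ≤ _ := by
          refine lintegral_mono_ae ?_
          filter_upwards [ae_restrict_mem₀
            (nullMeasurableSet_superlevel (w := fun y => |v x - v y|) hΩ (by fun_prop) 1)]
            with y ⟨hy, hjump⟩
          -- `y ≠ x`, so the kernel does not take its junk value `1 / 0 = 0`.
          have hpos : 0 < ‖x - y‖ := by
            refine norm_pos_iff.2 (sub_ne_zero.2 ?_)
            rintro rfl
            norm_num at hjump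
          have := hdiam x hx y hy
          gcongr
  have htotal : ENNReal.ofReal (κ / D ^ (2 * d) * volume.real Ω) ≤ ENNReal.ofReal M := by
    rw [ENNReal.ofReal_mul (by positivity), ofReal_measureReal hΩfin, ← setLIntegral_const]
    exact (lintegral_mono_ae ((ae_restrict_mem hΩ).mono hinner)).trans hM
  rw [ENNReal.ofReal_le_ofReal_iff hM0, div_mul_eq_mul_div, div_le_iff₀ (by positivity)] at htotal
  linarith

/-- Geometric decay of the level sets of `|v - m|`, which `volume_le_of_jump` propagates from one
integer level to the next. -/
lemma exists_volume_superlevel_le {d : ℕ} (hd : d ≠ 0) {Ω : Set (EuclideanSpace ℝ (Fin d))}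
    (hΩ : MeasurableSet Ω) (hΩfin : volume Ω ≠ ⊤) {c R D M θ : ℝ}
    (hc : 0 < c) (hR : 0 < R) (hD : 0 < D) (hM0 : 0 ≤ M)
    (hdens : ∀ x ∈ Ω, ∀ r : ℝ, 0 < r → r ≤ R →
      ENNReal.ofReal (c * r ^ d) ≤ volume (Metric.ball x r ∩ Ω))
    (hdiam : ∀ x ∈ Ω, ∀ y ∈ Ω, ‖x - y‖ ≤ D) {v : EuclideanSpace ℝ (Fin d) → ℝ}
    (hv : AEMeasurable v (volume.restrict Ω))
    (hM : ∫⁻ x in Ω, ∫⁻ y in {y ∈ Ω | 1 < |v x - v y|},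
      ENNReal.ofReal (1 / ‖x - y‖ ^ (2 * d)) ≤ ENNReal.ofReal M)
    (hθ : 0 ≤ θ) (hθ1 : θ ≤ 1) (hMθ : 4 * M / c ^ 2 ≤ θ)
    (hMκ : M * D ^ (2 * d) < c * R ^ d / 2 * volume.real Ω) :
    ∃ m : ℝ, ∀ k : ℕ, volume {x ∈ Ω | k + 1 < |v x - m|} ≤
      ENNReal.ofReal (θ ^ k * (c * R ^ d / 2)) := by
  obtain ⟨m, hm⟩ := exists_volume_jump_le hΩ hΩfin hD hM0 hdiam hv hM (by positivity) hMκ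
  refine ⟨m, fun k => ?_⟩
  induction k with
  | zero => simpa using hm
  | succ k ih =>
    have hsmall : θ ^ k * (c * R ^ d / 2) ≤ c * R ^ d / 2 :=
      mul_le_of_le_one_left (by positivity) (pow_le_one₀ hθ hθ1)
    refine (volume_le_of_jump (Q := {x ∈ Ω | k + 1 < |v x - m|}) hd hc hR hdens hM
      (nullMeasurableSet_superlevel hΩ (by fun_prop) _) ?_ (fun x hx => hx.1)
      (ih.trans (ENNReal.ofReal_le_ofReal hsmall)) ?_).trans ?_
    · rintro x ⟨hx, hxk⟩
      push_cast at hxk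
      exact ⟨hx, by linarith⟩
    · rintro x ⟨-, hxk⟩ y ⟨hy, hyk⟩
      have hyk' : |v y - m| ≤ k + 1 := not_lt.1 fun h => hyk ⟨hy, h⟩
      push_cast at hxk
      linarith [abs_sub_le (v x) (v y) m]
    · calc _ ≤ ENNReal.ofReal θ * ENNReal.ofReal (θ ^ k * (c * R ^ d / 2)) := by gcongr
        _ = _ := by
          rw [← ENNReal.ofReal_mul hθ]
          congr 1
          ring

/-! ### Exponential integrability -/

/-- Layer-cake estimate: level sets decaying with ratio `exp (-α) / 2` beat the growth
`exp (α * k)`. -/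
lemma lintegral_exp_le_of_superlevel_le {X : Type*} [MeasurableSpace X] {μ : Measure X}
    {Ω : Set X} {w : X → ℝ} (hw : AEMeasurable w (μ.restrict Ω)) {α κ : ℝ}
    (hα : 0 < α) (hκ : 0 ≤ κ)
    (h : ∀ k : ℕ, μ {x ∈ Ω | k + 1 < w x} ≤ ENNReal.ofReal ((Real.exp (-α) / 2) ^ k * κ)) :
    ∫⁻ x in Ω, ENNReal.ofReal (Real.exp (α * w x)) ∂μ ≤
      ENNReal.ofReal (Real.exp α) * μ Ω + ENNReal.ofReal (2 * κ * Real.exp (2 * α)) := by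
  have hmeas (k : ℕ) : NullMeasurableSet {x | (k : ℝ) + 1 < w x} (μ.restrict Ω) :=
    nullMeasurableSet_lt aemeasurable_const hw
  have hpt (x : X) : ENNReal.ofReal (Real.exp (α * w x)) ≤ ENNReal.ofReal (Real.exp α) +
      ∑' k : ℕ, {x | (k : ℝ) + 1 < w x}.indicator
        (fun _ => ENNReal.ofReal (Real.exp (α * (k + 2)))) x := by
    rcases le_or_gt (w x) 1 with hx | hx
    · refine le_add_right (ENNReal.ofReal_le_ofReal (Real.exp_le_exp.2 ?_))
      nlinarith
    · -- The layer `k + 1 < w x ≤ k + 2` containing `x`.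
      obtain ⟨k, hk1, hk2⟩ : ∃ k : ℕ, (k : ℝ) + 1 < w x ∧ w x ≤ k + 2 := by
        have hceil : 1 < ⌈w x⌉₊ := Nat.lt_ceil.2 (by simpa using hx)
        obtain ⟨k, hk⟩ := Nat.exists_eq_add_of_le' hceil
        refine ⟨k, by exact_mod_cast Nat.lt_ceil.1 (show k + 1 < ⌈w x⌉₊ by omega), ?_⟩
        exact_mod_cast Nat.ceil_le.1 (show ⌈w x⌉₊ ≤ k + 2 by omega)
      refine le_add_left (le_trans ?_ (ENNReal.le_tsum k))
      rw [Set.indicator_of_mem (show x ∈ {x | (k : ℝ) + 1 < w x} from hk1)]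
      gcongr
  refine (lintegral_mono hpt).trans ?_
  rw [lintegral_add_left measurable_const, setLIntegral_const,
    lintegral_tsum fun k => aemeasurable_const.indicator₀ (hmeas k)]
  gcongr
  have hterm (k : ℕ) : ∫⁻ x in Ω, {x | (k : ℝ) + 1 < w x}.indicator
      (fun _ => ENNReal.ofReal (Real.exp (α * (k + 2)))) x ∂μ ≤
      ENNReal.ofReal (κ * Real.exp (2 * α) * (1 / 2) ^ k) := by
    rw [lintegral_indicator₀ (hmeas k), setLIntegral_const, Measure.restrict_apply₀ (hmeas k)]
    have hset : {x | (k : ℝ) + 1 < w x} ∩ Ω = {x ∈ Ω | (k : ℝ) + 1 < w x} := by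
      ext x
      simp [and_comm]
    rw [hset]
    refine (mul_le_mul_right (h k) _).trans (le_of_eq ?_)
    rw [← ENNReal.ofReal_mul (by positivity)]
    congr 1
    have hexp : Real.exp (α * (k + 2)) = Real.exp α ^ k * Real.exp (2 * α) := by
      rw [← Real.exp_nat_mul, ← Real.exp_add]
      ring_nf
    rw [hexp, Real.exp_neg, div_pow, div_pow, inv_pow, one_pow]
    field_simp
  refine (ENNReal.tsum_le_tsum hterm).trans (le_of_eq ?_)
  rw [← ENNReal.ofReal_tsum_of_nonneg (fun k => by positivity)
    (summable_geometric_two.mul_left _), tsum_mul_left, tsum_geometric_two]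
  congr 1
  ring

/-- Passing from `|v - m|` to `|v|` costs only `exp` of the mean of `|v|`: the mean of
`α * |v - m|` is controlled by that of its exponential. -/
lemma integral_exp_abs_le {X : Type*} [MeasurableSpace X] {μ : Measure X} [IsFiniteMeasure μ]
    (hμ : 0 < μ.real Set.univ) {v : X → ℝ} (hv : Integrable v μ) {α m K : ℝ} (hα : 0 < α)
    (hK : 0 ≤ K)
    (h : ∫⁻ x, ENNReal.ofReal (Real.exp (α * |v x - m|)) ∂μ ≤ ENNReal.ofReal K) :
    Integrable (fun x => Real.exp (α * |v x|)) μ ∧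
      ∫ x, Real.exp (α * |v x|) ∂μ ≤ K * Real.exp (K / μ.real Set.univ) *
        Real.exp (α * ((μ.real Set.univ)⁻¹ * ∫ x, |v x| ∂μ)) := by
  have hvm : AEMeasurable v μ := hv.aemeasurable
  have hmeas : AEStronglyMeasurable (fun x => Real.exp (α * |v x - m|)) μ :=
    AEMeasurable.aestronglyMeasurable (by fun_prop)
  have hpos : 0 ≤ᵐ[μ] fun x => Real.exp (α * |v x - m|) := .of_forall fun x => (Real.exp_pos _).le
  have hint : Integrable (fun x => Real.exp (α * |v x - m|)) μ :=
    ⟨hmeas, (hasFiniteIntegral_iff_ofReal hpos).2 (h.trans_lt ENNReal.ofReal_lt_top)⟩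
  have hintK : ∫ x, Real.exp (α * |v x - m|) ∂μ ≤ K := by
    rw [integral_eq_lintegral_of_nonneg_ae hpos hmeas]
    exact ENNReal.toReal_le_of_le_ofReal hK h
  have hle (x : X) : Real.exp (α * |v x|) ≤ Real.exp (α * |m|) * Real.exp (α * |v x - m|) := by
    rw [← Real.exp_add, ← mul_add]
    gcongr
    linarith [abs_sub_abs_le_abs_sub (v x) m]
  have hintv : Integrable (fun x => Real.exp (α * |v x|)) μ := by
    refine (hint.const_mul (Real.exp (α * |m|))).mono'
      (AEMeasurable.aestronglyMeasurable (by fun_prop)) (.of_forall fun x => ?_)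
    rw [Real.norm_of_nonneg (Real.exp_pos _).le]
    exact hle x
  refine ⟨hintv, ?_⟩
  have hm : α * |m| ≤ K / μ.real Set.univ + α * ((μ.real Set.univ)⁻¹ * ∫ x, |v x| ∂μ) := by
    have hmean : ∫ _, α * |m| ∂μ ≤ ∫ x, (Real.exp (α * |v x - m|) + α * |v x|) ∂μ := by
      refine integral_mono (integrable_const _) (hint.add (hv.abs.const_mul α)) fun x => ?_
      have h1 : α * |m| ≤ α * |v x - m| + α * |v x| := by
        rw [← mul_add]
        gcongr
        linarith [abs_sub_abs_le_abs_sub m (v x), abs_sub_comm m (v x)]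
      have h2 := Real.add_one_le_exp (α * |v x - m|)
      dsimp only
      linarith
    rw [integral_const, smul_eq_mul, integral_add hint (hv.abs.const_mul α),
      integral_const_mul] at hmean
    rw [← mul_le_mul_iff_right₀ hμ]
    refine hmean.trans ((add_le_add_left hintK _).trans (le_of_eq ?_))
    field_simp
  calc ∫ x, Real.exp (α * |v x|) ∂μ
      ≤ ∫ x, Real.exp (α * |m|) * Real.exp (α * |v x - m|) ∂μ :=
        integral_mono hintv (hint.const_mul _) hle
    _ = Real.exp (α * |m|) * ∫ x, Real.exp (α * |v x - m|) ∂μ := integral_const_mul _ _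
    _ ≤ Real.exp (K / μ.real Set.univ + α * ((μ.real Set.univ)⁻¹ * ∫ x, |v x| ∂μ)) * K := by
        gcongr
    _ = _ := by
        rw [Real.exp_add]
        ring

theorem proposition2 (d : ℕ) (hd : 1 ≤ d) (Ω : Set (EuclideanSpace ℝ (Fin d)))
    (hΩ : IsSmoothBoundedOpen Ω) (α : ℝ) (hα : 0 < α) :
    ∃ M₀ C : ℝ, 0 < M₀ ∧ 0 < C ∧
      ∀ (δ : ℝ), 0 < δ → ∀ u : EuclideanSpace ℝ (Fin d) → ℝ, IntegrableOn u Ω volume →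
        ENNReal.ofReal (δ ^ (-(d : ℝ))) * nonlocalI δ (d : ℝ) u Ω ≤ ENNReal.ofReal M₀ →
          IntegrableOn (fun x => Real.exp (α * δ⁻¹ * |u x|)) Ω volume ∧
          ∫ x in Ω, Real.exp (α * δ⁻¹ * |u x|) ≤
            C * Real.exp (α * δ⁻¹ * ((volume.real Ω)⁻¹ * ∫ x in Ω, |u x|)) := by
  rcases Ω.eq_empty_or_nonempty with rfl | hne
  · exact ⟨1, 1, one_pos, one_pos, fun δ _ u _ _ => by simp⟩
  obtain ⟨c, R, hc, hR, hdens⟩ := hΩ.measure_density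
  obtain ⟨D, hD, hdiam⟩ : ∃ D > 0, ∀ x ∈ Ω, ∀ y ∈ Ω, ‖x - y‖ ≤ D := by
    refine ⟨Metric.diam Ω + 1, by positivity, fun x hx y hy => ?_⟩
    rw [← dist_eq_norm]
    linarith [Metric.dist_le_diam_of_mem hΩ.isBounded hx hy]
  have hΩm : MeasurableSet Ω := hΩ.isOpen.measurableSet
  have hΩfin : volume Ω ≠ ⊤ := hΩ.isBounded.measure_lt_top.ne
  have hV : 0 < volume.real Ω := ENNReal.toReal_pos (hΩ.isOpen.measure_pos _ hne).ne' hΩfin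
  set κ := c * R ^ d / 2 with hκ
  have hκ0 : 0 < κ := by positivity
  set θ := Real.exp (-α) / 2 with hθ
  have hθ0 : 0 < θ := by positivity
  have hθ1 : θ ≤ 1 := by
    have := Real.exp_le_one_iff.2 (neg_nonpos.2 hα.le)
    linarith
  set K := Real.exp α * volume.real Ω + 2 * κ * Real.exp (2 * α) with hK
  have hK0 : 0 < K := by positivity
  refine ⟨min (θ * c ^ 2 / 4) (κ * volume.real Ω / (2 * D ^ (2 * d))),
    K * Real.exp (K / volume.real Ω), by positivity, by positivity, ?_⟩
  intro δ hδ u hu hM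
  rw [ofReal_rpow_mul_nonlocalI hδ] at hM
  set M := min (θ * c ^ 2 / 4) (κ * volume.real Ω / (2 * D ^ (2 * d))) with hMdef
  have hMθ : 4 * M / c ^ 2 ≤ θ := by
    rw [div_le_iff₀ (by positivity)]
    linarith [min_le_left (θ * c ^ 2 / 4) (κ * volume.real Ω / (2 * D ^ (2 * d)))]
  have hMκ : M * D ^ (2 * d) < κ * volume.real Ω := by
    have h := min_le_right (θ * c ^ 2 / 4) (κ * volume.real Ω / (2 * D ^ (2 * d)))
    rw [le_div_iff₀ (by positivity)] at h
    nlinarith [mul_pos hκ0 hV]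
  have hv : IntegrableOn (fun x => δ⁻¹ * u x) Ω volume := hu.const_mul _
  have hvm : AEMeasurable (fun x => δ⁻¹ * u x) (volume.restrict Ω) := hv.aemeasurable
  obtain ⟨m, hm⟩ := exists_volume_superlevel_le (by omega) hΩm hΩfin hc hR hD
    (by positivity) hdens hdiam hvm hM hθ0.le hθ1 hMθ hMκ
  have hexp := lintegral_exp_le_of_superlevel_le (w := fun x => |δ⁻¹ * u x - m|) (by fun_prop)
    hα hκ0.le hm
  rw [← ofReal_measureReal hΩfin, ← ENNReal.ofReal_mul (by positivity),
    ← ENNReal.ofReal_add (by positivity) (by positivity)] at hexp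
  have : IsFiniteMeasure (volume.restrict Ω) := isFiniteMeasure_restrict.2 hΩfin
  have hmain := integral_exp_abs_le (by simpa using hV) hv hα hK0.le hexp
  have habs (x : EuclideanSpace ℝ (Fin d)) : |δ⁻¹ * u x| = δ⁻¹ * |u x| := by
    rw [abs_mul, abs_of_pos (inv_pos.2 hδ)]
  simp only [habs, integral_const_mul, measureReal_restrict_apply_univ, ← mul_assoc] at hmain ⊢
  refine ⟨hmain.1, hmain.2.trans (le_of_eq ?_)⟩
  congr 2
  ring
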